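/- Let $J(2)$ be the hedgehog with two spines, i.e. the set $\{0\}\cup\big((0,1]\times\{1,2\}\big)$ with the metric $d(0,\langle s,a\rangle)=s$, $d(\langle s,a\rangle,\langle t,a\rangle)=|s-t|$ and $d(\langle s,a\rangle,\langle t,b\rangle)=s+t$ for $a\neq b$ (it is isometric to $[-1,1]$ with the usual metric). For maps $\theta,\Phi$ assigning to each point $x$ of a space $X$ a nonempty subset of $J(2)$, write $\theta\leqslant\Phi$ if $\theta(x)\subseteq\Phi(x)$ for all $x\in X$, and $\theta<\Phi$ if moreover $\Phi(x)\setminus\theta(x)\neq\emptyset$ for all $x\in X$. Such a map $\Phi$ is l.s.c. if $\{x\in X:\Phi(x)\cap U\neq\emptyset\}$ is open for every open $U\subseteq J(2)$, u.s.c. if $\{x\in X:\Phi(x)\cap F\neq\emptyset\}$ is closed for every closed $F\subseteq J(2)$, and continuous if it is both. A space is countably paracompact if every countable open cover of it has a locally finite open refinement. For a Hausdorff topological space $X$, the following conditions are equivalent: 1. $X$ is countably paracompact and normal. 2. If $\Phi$ is an l.s.c. map from $X$ to the nonempty closed connected subsets of $J(2)$, $\theta$ is a u.s.c. map from $X$ to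 the nonempty compact subsets of $J(2)$, and $\theta<\Phi$, then there exists a continuous map $\varphi$ from $X$ to the nonempty compact connected subsets of $J(2)$ such that $\theta<\varphi\leqslant\Phi$. 3. If $\xi:X\to\mathbb{R}$ is upper semicontinuous, $\eta:X\to\mathbb{R}$ is lower semicontinuous and $\xi(x)<\eta(x)$ for all $x\in X$, then there exists a continuous function $f:X\to\mathbb{R}$ such that $\xi(x)<f(x)<\eta(x)$ for all $x\in X$. -/

import Mathlib

namespace SetInsertion

/-- The point set `{0} ∪ (0,1] × A` of the hedgehog with set of spines `A`. -/
inductive Hedgehog (A : Type*) where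
  | zero : Hedgehog A
  | point (s : Set.Ioc (0 : ℝ) 1) (a : A) : Hedgehog A

namespace Hedgehog

open Classical in
/-- The hedgehog distance: `d(0, ⟨s, a⟩) = s`, and `d(⟨s, a⟩, ⟨t, b⟩)` is `|s - t|` if `a = b`
and `s + t` otherwise. -/
noncomputable def hdist {A : Type*} : Hedgehog A → Hedgehog A → ℝ
  | zero, zero => 0
  | zero, point s _ => s
  | point s _, zero => s
  | point s a, point t b => if a = b then |(s : ℝ) - t| else (s : ℝ) + t

/-- The metrizable hedgehog with set of spines `A`, always with the metric `hdist` and the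
topology induced by it. -/
noncomputable instance instMetricSpace {A : Type*} : MetricSpace (Hedgehog A) where
  dist := hdist
  dist_self x := by cases x <;> simp [hdist]
  dist_comm x y := by
    cases x <;> cases y <;> simp only [hdist]
    rw [abs_sub_comm, add_comm]
    congr 1
    exact propext eq_comm
  dist_triangle x y z := by
    rcases x with _ | ⟨⟨s, hs, -⟩, a⟩ <;> rcases y with _ | ⟨⟨t, ht, -⟩, b⟩ <;>
      rcases z with _ | ⟨⟨r, hr, -⟩, c⟩ <;> simp only [hdist] <;> try split_ifs
    all_goals first
      | (subst_vars; contradiction)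
      | (try simp only [abs_eq_max_neg]); grind
  eq_of_dist_eq_zero := by
    intro x y h
    change hdist x y = 0 at h
    rcases x with _ | ⟨⟨s, hs, hs'⟩, a⟩ <;> rcases y with _ | ⟨⟨t, ht, ht'⟩, b⟩ <;>
      simp only [hdist] at h
    · rfl
    · exact absurd h ht.ne'
    · exact absurd h hs.ne'
    · split_ifs at h with hab
      · obtain rfl : s = t := by linarith [abs_eq_zero.1 h]
        rw [hab]
      · linarith

end Hedgehog

/-- A space is countably paracompact if each countable open cover has a locally finite open
refinement (which is again a cover). -/
def CountablyParacompact (X : Type*) [TopologicalSpace X] : Prop :=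
  ∀ 𝒰 : Set (Set X), 𝒰.Countable → (∀ U ∈ 𝒰, IsOpen U) → ⋃₀ 𝒰 = Set.univ →
    ∃ 𝒱 : Set (Set X), (∀ V ∈ 𝒱, IsOpen V) ∧ ⋃₀ 𝒱 = Set.univ ∧
      LocallyFinite (fun V : 𝒱 => (V : Set X)) ∧ ∀ V ∈ 𝒱, ∃ U ∈ 𝒰, V ⊆ U

/-- The nonempty compact closed subsets of `Y`. -/
def compactSubsets (Y : Type*) [TopologicalSpace Y] : Set (Set Y) :=
  {S | S.Nonempty ∧ IsClosed S ∧ IsCompact S}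

/-- The nonempty closed connected subsets of `Y` (`IsConnected` includes nonemptiness). -/
def closedConnectedSubsets (Y : Type*) [TopologicalSpace Y] : Set (Set Y) :=
  {S | IsClosed S ∧ IsConnected S}

/-- The nonempty compact connected closed subsets of `Y`. -/
def compactConnectedSubsets (Y : Type*) [TopologicalSpace Y] : Set (Set Y) :=
  {S | IsClosed S ∧ IsCompact S ∧ IsConnected S}

/-- `θ ≤ Φ`: `θ` is a set-valued selection for `Φ`. -/
def IsSelection {X Y : Type*} (θ Φ : X → Set Y) : Prop :=
  ∀ x, θ x ⊆ Φ x

/-- `θ < Φ`: `θ` is a selection for `Φ` and `Φ x \ θ x` is nonempty for all `x`. -/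
def IsStrictSelection {X Y : Type*} (θ Φ : X → Set Y) : Prop :=
  IsSelection θ Φ ∧ ∀ x, (Φ x \ θ x).Nonempty

/-- A set-valued mapping is continuous if it is both l.s.c. and u.s.c. -/
def ContinuousSetValued {X Y : Type*} [TopologicalSpace X] [TopologicalSpace Y]
    (φ : X → Set Y) : Prop :=
  LowerHemicontinuous φ ∧ UpperHemicontinuous φ

end SetInsertion

open Set Filter Topology

namespace SetInsertion

/-! ### Real-valued insertion, normality and countable paracompactness. -/

section Insertion

variable {X : Type*} [TopologicalSpace X]

/-! `J(2)` is a copy of `[-1, 1]`, so its nonempty closed connected subsets are compact intervals,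
and a set-valued map into them is a pair of semicontinuous endpoints. From 1, partitions of unity
subordinate to countable covers indexed by `ℚ` give 3 by averaging. For 2, the same device adds to
`θ x` finitely many rationals inside `Φ x` but outside `θ x`; weak (Katětov–Tong) insertion on each
side of this enlarged set then supplies continuous endpoints. Conversely, 2 applied to `[-1, ξ] <
[-1, η]` yields strict insertion for functions bounded by `-1` and `1`. This bounded form, also a
special case of 3, already implies 1, because the test functions needed for normality and for
countable paracompactness are bounded. -/

/-- Any pair of an upper and a strictly larger lower semicontinuous real function can be strictly
separated by a continuous function. -/
def StrictInsertion (X : Type*) [TopologicalSpace X] : Prop :=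
  ∀ ξ η : X → ℝ, UpperSemicontinuous ξ → LowerSemicontinuous η → (∀ x, ξ x < η x) →
    ∃ f : X → ℝ, Continuous f ∧ (∀ x, ξ x < f x) ∧ ∀ x, f x < η x

/-- Strict insertion for functions with values in `[-1, 1]`. -/
def BoundedStrictInsertion (X : Type*) [TopologicalSpace X] : Prop :=
  ∀ ξ η : X → ℝ, UpperSemicontinuous ξ → LowerSemicontinuous η → (∀ x, -1 ≤ ξ x) →
    (∀ x, η x ≤ 1) → (∀ x, ξ x < η x) →
    ∃ f : X → ℝ, Continuous f ∧ (∀ x, ξ x < f x) ∧ ∀ x, f x < η x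

theorem CountablyParacompact.exists_partitionOfUnity {X : Type u} [TopologicalSpace X]
    [NormalSpace X] (h : CountablyParacompact X) {κ : Type*} [Countable κ] (U : κ → Set X)
    (hU : ∀ k, IsOpen (U k)) (hcov : ∀ x, ∃ k, x ∈ U k) :
    ∃ (ι : Type u) (ρ : PartitionOfUnity ι X univ) (k : ι → κ),
      ∀ i, tsupport (ρ i) ⊆ U (k i) := by
  obtain ⟨𝒱, hVo, hVcov, hVlf, hVU⟩ := h (range U) (countable_range U)
    (by rintro _ ⟨k, rfl⟩; exact hU k)
    (eq_univ_of_forall fun x => let ⟨k, hk⟩ := hcov x; ⟨U k, ⟨k, rfl⟩, hk⟩)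
  have hex : ∀ V : 𝒱, ∃ k, (V : Set X) ⊆ U k := by
    rintro ⟨V, hV⟩
    obtain ⟨_, ⟨k, rfl⟩, hk⟩ := hVU V hV
    exact ⟨k, hk⟩
  choose k hk using hex
  obtain ⟨ρ, hρ⟩ := PartitionOfUnity.exists_isSubordinate_of_locallyFinite isClosed_univ
    (fun V : 𝒱 => (V : Set X)) (fun V => hVo V V.2) hVlf (by rw [← sUnion_eq_iUnion, hVcov])
  exact ⟨𝒱, ρ, k, fun V => (hρ V).trans (hk V)⟩

theorem CountablyParacompact.strictInsertion [NormalSpace X] (h : CountablyParacompact X) :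
    StrictInsertion X := by
  intro ξ η hξ hη hlt
  obtain ⟨ι, ρ, q, hq⟩ := h.exists_partitionOfUnity (fun q : ℚ => {x | ξ x < q ∧ (q : ℝ) < η x})
    (fun q => (hξ.isOpen _).inter (hη.isOpen _)) (fun x => exists_rat_btwn (hlt x))
  -- Every `q i` with nonzero weight at `x` lies in the convex set `Ioo (ξ x) (η x)`.
  have key : ∀ x, ∑ᶠ i, ρ i x • (q i : ℝ) ∈ Ioo (ξ x) (η x) := fun x =>
    ρ.finsum_smul_mem_convex (g := fun i _ => (q i : ℝ)) (mem_univ x)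
      (fun i hi => hq i (subset_tsupport _ hi)) (convex_Ioo _ _)
  exact ⟨fun x => ∑ᶠ i, ρ i x • (q i : ℝ),
    ρ.continuous_finsum_smul (g := fun i _ => (q i : ℝ)) fun _ _ _ => continuousAt_const,
    fun x => (key x).1, fun x => (key x).2⟩

/-- The Katětov–Tong insertion theorem, as a consequence of strict insertion. -/
theorem StrictInsertion.exists_continuous_between (h : StrictInsertion X) {ξ η : X → ℝ}
    (hξ : UpperSemicontinuous ξ) (hη : LowerSemicontinuous η) (hle : ∀ x, ξ x ≤ η x) :
    ∃ f : X → ℝ, Continuous f ∧ (∀ x, ξ x ≤ f x) ∧ ∀ x, f x ≤ η x := by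
  let P : ℕ → (X → ℝ) → Prop := fun n f =>
    Continuous f ∧ ∀ x, ξ x - 1 / 2 ^ n < f x ∧ f x < η x + 1 / 2 ^ n
  have hξc : ∀ c : ℝ, UpperSemicontinuous fun x => ξ x - c := fun c => by
    simpa only [sub_eq_add_neg] using hξ.add upperSemicontinuous_const
  have hηc : ∀ c : ℝ, LowerSemicontinuous fun x => η x + c := fun c =>
    hη.add lowerSemicontinuous_const
  have start : ∃ f, P 0 f := by
    obtain ⟨f, hf, h1, h2⟩ := h _ _ (hξc (1 / 2 ^ 0)) (hηc (1 / 2 ^ 0))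
      (fun x => by have := hle x; norm_num; linarith)
    exact ⟨f, hf, fun x => ⟨h1 x, h2 x⟩⟩
  have step : ∀ (n : ℕ) (f : {f // P n f}), ∃ g : {g // P (n + 1) g},
      ∀ x, dist (f.1 x) (g.1 x) ≤ 2 / 2 / 2 ^ n := by
    rintro n ⟨f, hf, hfb⟩
    have hpos : (0 : ℝ) < 1 / 2 ^ n := by positivity
    have hpos' : (0 : ℝ) < 1 / 2 ^ (n + 1) := by positivity
    have hlt : (1 : ℝ) / 2 ^ (n + 1) < 1 / 2 ^ n := by
      have : (1 : ℝ) / 2 ^ (n + 1) = 1 / 2 ^ n / 2 := by rw [pow_succ]; field_simp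
      linarith
    obtain ⟨g, hg, h1, h2⟩ := h (fun x => (ξ x - 1 / 2 ^ (n + 1)) ⊔ (f x - 1 / 2 ^ n))
      (fun x => (η x + 1 / 2 ^ (n + 1)) ⊓ (f x + 1 / 2 ^ n))
      ((hξc _).sup (hf.sub continuous_const).upperSemicontinuous)
      ((hηc _).inf (hf.add continuous_const).lowerSemicontinuous) (fun x => by
        have := hle x
        have := hfb x
        simp only [sup_lt_iff, lt_inf_iff]
        refine ⟨⟨?_, ?_⟩, ?_, ?_⟩ <;> linarith)
    refine ⟨⟨g, hg, fun x => ⟨(le_sup_left).trans_lt (h1 x), (h2 x).trans_le inf_le_left⟩⟩,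
      fun x => ?_⟩
    have h3 := (le_sup_right).trans_lt (h1 x)
    have h4 := (h2 x).trans_le inf_le_right
    rw [Real.dist_eq, abs_le, div_self two_ne_zero]
    constructor <;> linarith
  choose g hg using step
  obtain ⟨f₀, hf₀⟩ := start
  let F : ∀ n, {f // P n f} := fun n => Nat.rec ⟨f₀, hf₀⟩ g n
  have hF : ∀ x n, dist ((F n).1 x) ((F (n + 1)).1 x) ≤ 2 / 2 / 2 ^ n := fun x n => hg n (F n) x
  choose f hf using fun x => cauchySeq_tendsto_of_complete (cauchySeq_of_le_geometric_two (hF x))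
  have hlim : Tendsto (fun n : ℕ => (1 : ℝ) / 2 ^ n) atTop (𝓝 0) := by
    simpa using tendsto_pow_atTop_nhds_zero_of_lt_one (r := (1 / 2 : ℝ)) (by norm_num)
      (by norm_num)
  refine ⟨f, ?_, fun x => ?_, fun x => ?_⟩
  · have hu : TendstoUniformly (fun n => (F n).1) f atTop := by
      rw [Metric.tendstoUniformly_iff]
      intro ε hε
      have := (hlim.const_mul 2).eventually (gt_mem_nhds (by simpa using hε))
      filter_upwards [this] with n hn x
      rw [dist_comm]
      refine (dist_le_of_le_geometric_two_of_tendsto (hF x) (hf x) n).trans_lt ?_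
      rwa [mul_one_div] at hn
    exact hu.continuous (Eventually.frequently (Eventually.of_forall fun n => (F n).2.1))
  · have := (tendsto_const_nhds (x := ξ x)).sub hlim
    rw [sub_zero] at this
    exact le_of_tendsto_of_tendsto' this (hf x) fun n => ((F n).2.2 x).1.le
  · have := (tendsto_const_nhds (x := η x)).add hlim
    rw [add_zero] at this
    exact le_of_tendsto_of_tendsto' (hf x) this fun n => ((F n).2.2 x).2.le

/-- The lower function is `1/2` on `s` and `0` elsewhere, the upper one `1/2` on `t` and `1`
elsewhere; the level `1/2` of an inserted function separates `s` from `t`. -/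
theorem BoundedStrictInsertion.normalSpace (h : BoundedStrictInsertion X) : NormalSpace X := by
  refine ⟨fun s t hs ht hst => ?_⟩
  obtain ⟨f, hf, h1, h2⟩ := h (s.indicator fun _ => 1 / 2)
    (fun x => t.indicator (fun _ => -(1 / 2)) x + 1)
    (hs.upperSemicontinuous_indicator (by norm_num))
    ((ht.lowerSemicontinuous_indicator (by norm_num)).add lowerSemicontinuous_const)
    (fun x => by by_cases hx : x ∈ s <;> simp [hx]; norm_num)
    (fun x => by by_cases hx : x ∈ t <;> simp [hx])
    (fun x => by
      by_cases hx : x ∈ s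
      · have hxt : x ∉ t := fun hxt => hst.le_bot ⟨hx, hxt⟩
        simp only [hx, hxt, indicator_of_mem, indicator_of_notMem, not_false_eq_true]; norm_num
      · by_cases hxt : x ∈ t <;>
          simp only [hx, hxt, indicator_of_mem, indicator_of_notMem, not_false_eq_true] <;>
          norm_num)
  refine ⟨{x | 1 / 2 < f x}, {x | f x < 1 / 2}, isOpen_lt continuous_const hf,
    isOpen_lt hf continuous_const, fun x hx => ?_, fun x hx => ?_, ?_⟩
  · simpa [hx] using h1 x
  · have := h2 x
    simp only [hx, indicator_of_mem] at this
    rw [mem_ofPred_eq]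
    linarith
  · exact disjoint_left.2 fun x (hx : 1 / 2 < f x) (hx' : f x < 1 / 2) => lt_asymm hx hx'

/-- With `N x` the first index of a cover member containing `x`, insert `0 < f < 1 / (N + 1)` and
cut `U n` down to where `f < 1 / (n + 1)`. Near a point `f` is bounded away from `0`, so only
finitely many cut sets survive. -/
theorem BoundedStrictInsertion.countablyParacompact (h : BoundedStrictInsertion X) :
    CountablyParacompact X := by
  classical
  intro 𝒰 hc ho hcov
  rcases 𝒰.eq_empty_or_nonempty with rfl | hne
  · exact ⟨∅, by simp, hcov, locallyFinite_of_finite _, by simp⟩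
  obtain ⟨U, rfl⟩ := hc.exists_eq_range hne
  have hU : ∀ n, IsOpen (U n) := fun n => ho _ ⟨n, rfl⟩
  have hex : ∀ x, ∃ n, x ∈ U n := fun x => by
    obtain ⟨_, ⟨n, rfl⟩, hx⟩ := hcov.ge (mem_univ x)
    exact ⟨n, hx⟩
  let N : X → ℕ := fun x => Nat.find (hex x)
  obtain ⟨f, hf, hpos, hlt⟩ := h (fun _ => 0) (fun x => 1 / ((N x : ℝ) + 1))
    upperSemicontinuous_const (by
      intro x y hy
      filter_upwards [(hU (N x)).mem_nhds (Nat.find_spec (hex x))] with z hz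
      refine lt_of_lt_of_le hy (one_div_le_one_div_of_le (by positivity) ?_)
      have : N z ≤ N x := Nat.find_min' _ hz
      gcongr)
    (fun _ => by norm_num)
    (fun x => by
      rw [div_le_one (by positivity)]
      linarith [(N x).cast_nonneg (α := ℝ)])
    (fun x => by positivity)
  let V : ℕ → Set X := fun n => U n ∩ {x | f x < 1 / ((n : ℝ) + 1)}
  have hV : LocallyFinite V := by
    intro x
    obtain ⟨n, hn⟩ := exists_nat_one_div_lt (hpos x)
    refine ⟨{y | 1 / ((n : ℝ) + 1) < f y}, (isOpen_lt continuous_const hf).mem_nhds hn,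
      (finite_Iio n).subset ?_⟩
    rintro m ⟨y, ⟨-, hy : f y < _⟩, hy' : _ < f y⟩
    by_contra hm
    have hnm : (n : ℝ) ≤ m := by exact_mod_cast not_lt.1 hm
    exact absurd (hy'.trans hy) (not_lt.2 (one_div_le_one_div_of_le (by positivity) (by linarith)))
  refine ⟨range V, ?_, ?_, hV.on_range, ?_⟩
  · rintro _ ⟨n, rfl⟩
    exact (hU n).inter (isOpen_lt hf continuous_const)
  · exact eq_univ_of_forall fun x =>
      ⟨V (N x), ⟨N x, rfl⟩, Nat.find_spec (hex x), hlt x⟩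
  · rintro _ ⟨n, rfl⟩
    exact ⟨U n, ⟨n, rfl⟩, inter_subset_left⟩

end Insertion

/-! ### Interval-valued maps and their semicontinuous endpoints. -/

section Hemicontinuity

variable {X Y Z : Type*} [TopologicalSpace X] [TopologicalSpace Y] [TopologicalSpace Z]

theorem lowerHemicontinuous_image {φ : X → Set Y} (hφ : LowerHemicontinuous φ) {g : Y → Z}
    (hg : Continuous g) : LowerHemicontinuous fun x => g '' φ x := by
  rw [lowerHemicontinuous_iff_isOpen_inter_nonempty] at hφ ⊢
  intro U hU
  simpa only [image_inter_nonempty_iff] using hφ _ (hU.preimage hg)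

theorem upperHemicontinuous_image {φ : X → Set Y} (hφ : UpperHemicontinuous φ) {g : Y → Z}
    (hg : Continuous g) : UpperHemicontinuous fun x => g '' φ x := by
  rw [upperHemicontinuous_iff_forall_isOpen] at hφ ⊢
  intro x U hU
  simpa only [image_subset_iff] using hφ x _ (hU.preimage hg)

variable {a b : X → ℝ}

theorem lowerHemicontinuous_Icc (ha : UpperSemicontinuous a) (hb : LowerSemicontinuous b)
    (hab : ∀ x, a x ≤ b x) : LowerHemicontinuous fun x => Icc (a x) (b x) := by
  rw [lowerHemicontinuous_iff_isOpen_inter_nonempty]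
  refine fun U hU => isOpen_iff_mem_nhds.2 ?_
  rintro x ⟨t, ⟨hat, htb⟩, htU⟩
  obtain ⟨ε, hε, hball⟩ := Metric.isOpen_iff.1 hU t htU
  filter_upwards [ha x (t + ε) (by linarith), hb x (t - ε) (by change _ < _; linarith)]
    with y hya (hyb : t - ε < b y)
  have := hab y
  -- Clamping `t` to `[a y, b y]` moves it by less than `ε`.
  refine ⟨max (a y) (min t (b y)), ⟨le_max_left _ _, max_le this (min_le_right _ _)⟩, hball ?_⟩
  rw [Metric.mem_ball, Real.dist_eq, abs_lt]
  constructor <;> grind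

theorem upperHemicontinuous_Icc (ha : LowerSemicontinuous a) (hb : UpperSemicontinuous b)
    (hab : ∀ x, a x ≤ b x) : UpperHemicontinuous fun x => Icc (a x) (b x) := by
  rw [upperHemicontinuous_iff_forall_isOpen]
  intro x U hU hsub
  obtain ⟨ε, hε, hball⟩ := isCompact_Icc.exists_thickening_subset_open hU hsub
  filter_upwards [ha x (a x - ε) (by change _ < _; linarith), hb x (b x + ε) (by linarith)]
    with y (hya : a x - ε < a y) hyb
  rintro t ⟨h1, h2⟩
  have := hab x
  refine hball (Metric.mem_thickening_iff.2 ⟨max (a x) (min t (b x)),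
    ⟨le_max_left _ _, max_le this (min_le_right _ _)⟩, ?_⟩)
  rw [Real.dist_eq, abs_lt]
  constructor <;> grind

variable {θ : X → Set ℝ}

theorem lowerSemicontinuous_sInf (hθ : UpperHemicontinuous θ) (hc : ∀ x, IsCompact (θ x))
    (hne : ∀ x, (θ x).Nonempty) : LowerSemicontinuous fun x => sInf (θ x) := by
  intro x c hcx
  filter_upwards [hθ.forall_isOpen x (Ioi c) isOpen_Ioi
    fun t ht => lt_of_lt_of_le hcx (csInf_le (hc x).bddBelow ht)] with y hy
  exact hy ((hc y).sInf_mem (hne y))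

theorem upperSemicontinuous_sSup (hθ : UpperHemicontinuous θ) (hc : ∀ x, IsCompact (θ x))
    (hne : ∀ x, (θ x).Nonempty) : UpperSemicontinuous fun x => sSup (θ x) := by
  intro x c hcx
  filter_upwards [hθ.forall_isOpen x (Iio c) isOpen_Iio
    fun t ht => lt_of_le_of_lt (le_csSup (hc x).bddAbove ht) hcx] with y hy
  exact hy ((hc y).sSup_mem (hne y))

theorem upperSemicontinuous_sInf (hθ : LowerHemicontinuous θ) (hc : ∀ x, IsCompact (θ x))
    (hne : ∀ x, (θ x).Nonempty) : UpperSemicontinuous fun x => sInf (θ x) := by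
  intro x c hcx
  filter_upwards [(lowerHemicontinuous_iff_isOpen_inter_nonempty.1 hθ (Iio c) isOpen_Iio).mem_nhds
    ⟨_, (hc x).sInf_mem (hne x), hcx⟩] with y ⟨t, ht, htc⟩
  exact lt_of_le_of_lt (csInf_le (hc y).bddBelow ht) htc

theorem lowerSemicontinuous_sSup (hθ : LowerHemicontinuous θ) (hc : ∀ x, IsCompact (θ x))
    (hne : ∀ x, (θ x).Nonempty) : LowerSemicontinuous fun x => sSup (θ x) := by
  intro x c hcx
  filter_upwards [(lowerHemicontinuous_iff_isOpen_inter_nonempty.1 hθ (Ioi c) isOpen_Ioi).mem_nhds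
    ⟨_, (hc x).sSup_mem (hne x), hcx⟩] with y ⟨t, ht, htc⟩
  exact lt_of_lt_of_le htc (le_csSup (hc y).bddAbove ht)

/-- The interval form of the set-valued insertion theorem. -/
theorem CountablyParacompact.exists_continuous_Icc_between [NormalSpace X]
    (h : CountablyParacompact X) {Ψ : X → Set ℝ} (hΨ : LowerHemicontinuous Ψ)
    (hΨc : ∀ x, IsCompact (Ψ x)) (hΨconn : ∀ x, IsConnected (Ψ x)) (hθ : UpperHemicontinuous θ)
    (hθc : ∀ x, IsCompact (θ x)) (hθne : ∀ x, (θ x).Nonempty) (hlt : IsStrictSelection θ Ψ) :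
    ∃ a b : X → ℝ, Continuous a ∧ Continuous b ∧ (∀ x, a x ≤ b x) ∧
      IsStrictSelection θ (fun x => Icc (a x) (b x)) ∧
      IsSelection (fun x => Icc (a x) (b x)) Ψ := by
  classical
  have hne : ∀ x, (Ψ x).Nonempty := fun x => (hΨconn x).nonempty
  have hIcc : ∀ x, Ψ x = Icc (sInf (Ψ x)) (sSup (Ψ x)) := fun x =>
    eq_Icc_of_connected_compact (hΨconn x) (hΨc x)
  have hA := upperSemicontinuous_sInf hΨ hΨc hne
  have hB := lowerSemicontinuous_sSup hΨ hΨc hne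
  obtain ⟨ι, ρ, q, hq⟩ := h.exists_partitionOfUnity
    (fun q : ℚ => {x | (sInf (Ψ x) < q ∧ (q : ℝ) < sSup (Ψ x)) ∧ θ x ⊆ {(q : ℝ)}ᶜ})
    (fun q => ((hA.isOpen _).inter (hB.isOpen _)).inter
      (upperHemicontinuous_iff_isOpen_preimage_Iic.1 hθ _ isOpen_compl_singleton)) (by
      intro x
      obtain ⟨t, htΨ, htθ⟩ := hlt.2 x
      obtain ⟨s, hs⟩ := hθne x
      have hsΨ := hlt.1 x hs
      have hst : s ≠ t := fun e => htθ (e ▸ hs)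
      rw [hIcc x] at htΨ hsΨ
      have hAB : sInf (Ψ x) ≠ sSup (Ψ x) := fun e => by
        rw [← e, Icc_self] at htΨ hsΨ
        exact hst (hsΨ.trans htΨ.symm)
      -- `t` may be an endpoint of `Ψ x`; being a limit of interior points and outside the closed
      -- set `θ x`, it can be replaced by an interior rational.
      rw [← closure_Ioo hAB] at htΨ
      obtain ⟨r, hr⟩ := Rat.denseRange_cast.exists_mem_open
        (isOpen_Ioo.inter (hθc x).isClosed.isOpen_compl)
        ((mem_closure_iff.1 htΨ _ (hθc x).isClosed.isOpen_compl htθ).mono (inter_comm _ _).subset)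
      exact ⟨r, hr.1, fun u hu e => hr.2 (e ▸ hu)⟩)
  -- Closed supports are used because the set of those containing a point can only shrink nearby,
  -- which makes `T` u.s.c.
  let T : X → Set ℝ := fun x => (fun i => (q i : ℝ)) '' (ρ.fintsupport x : Set ι)
  have hTfin : ∀ x, (T x).Finite := fun x => (ρ.fintsupport x).finite_toSet.image _
  have hT : UpperHemicontinuous T := by
    rw [upperHemicontinuous_iff_forall_isOpen]
    intro x U _ hsub
    filter_upwards [ρ.eventually_fintsupport_subset x] with y hy
    exact (image_mono (Finset.coe_subset.2 hy)).trans hsub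
  have hmem : ∀ x i, i ∈ ρ.fintsupport x →
      (sInf (Ψ x) < q i ∧ (q i : ℝ) < sSup (Ψ x)) ∧ θ x ⊆ {(q i : ℝ)}ᶜ := fun x i hi =>
    hq i ((ρ.mem_fintsupport_iff x i).1 hi)
  have hTΨ : ∀ x, T x ⊆ Ψ x := by
    rintro x _ ⟨i, hi, rfl⟩
    rw [hIcc x]
    exact ⟨(hmem x i hi).1.1.le, (hmem x i hi).1.2.le⟩
  have hu := hθ.union hT
  have huc : ∀ x, IsCompact (θ x ∪ T x) := fun x => (hθc x).union (hTfin x).isCompact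
  have hune : ∀ x, (θ x ∪ T x).Nonempty := fun x => (hθne x).inl
  have huΨ : ∀ x, θ x ∪ T x ⊆ Ψ x := fun x => union_subset (hlt.1 x) (hTΨ x)
  have hS := h.strictInsertion
  obtain ⟨a, ha, ha1, ha2⟩ := hS.exists_continuous_between hA (lowerSemicontinuous_sInf hu huc hune)
    fun x => csInf_le_csInf (hΨc x).bddBelow (hune x) (huΨ x)
  obtain ⟨b, hb, hb1, hb2⟩ := hS.exists_continuous_between (upperSemicontinuous_sSup hu huc hune) hB
    fun x => csSup_le_csSup (hΨc x).bddAbove (hune x) (huΨ x)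
  have hsub : ∀ x, θ x ∪ T x ⊆ Icc (a x) (b x) := fun x t ht =>
    ⟨(ha2 x).trans (csInf_le (huc x).bddBelow ht), (le_csSup (huc x).bddAbove ht).trans (hb1 x)⟩
  refine ⟨a, b, ha, hb, fun x => ?_, ⟨fun x => subset_union_left.trans (hsub x), fun x => ?_⟩,
    fun x => ?_⟩
  · obtain ⟨t, ht⟩ := hune x
    exact (hsub x ht).1.trans (hsub x ht).2
  · obtain ⟨i, hi⟩ := ρ.exists_pos (mem_univ x)
    have hi' : i ∈ ρ.fintsupport x := (ρ.mem_fintsupport_iff x i).2 (subset_tsupport _ hi.ne')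
    exact ⟨q i, hsub x (Or.inr ⟨i, hi', rfl⟩), fun hθi => (hmem x i hi').2 hθi rfl⟩
  · rw [hIcc x]
    exact Icc_subset_Icc (ha1 x) (hb2 x)

end Hemicontinuity

/-! ### Identification of the two-spined hedgehog with `[-1, 1]`. -/

namespace Hedgehog

/-- The isometry of the hedgehog with two spines onto `[-1, 1]`. -/
noncomputable def toReal : Hedgehog (Fin 2) → ℝ
  | zero => 0
  | point s a => if a = 0 then -s else s

theorem isometry_toReal : Isometry toReal := by
  refine Isometry.of_dist_eq fun x y => ?_
  change _ = hdist x y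
  rw [Real.dist_eq]
  rcases x with _ | ⟨⟨s, hs, -⟩, a⟩ <;> rcases y with _ | ⟨⟨t, ht, -⟩, b⟩ <;>
    simp only [hdist, toReal, abs_eq_max_neg] <;> grind

theorem toReal_mem_Icc (y : Hedgehog (Fin 2)) : toReal y ∈ Icc (-1 : ℝ) 1 := by
  rcases y with _ | ⟨⟨s, hs, hs'⟩, a⟩ <;> simp only [toReal, mem_Icc] <;> grind

theorem exists_toReal_eq {r : ℝ} (hr : r ∈ Icc (-1 : ℝ) 1) : ∃ y, toReal y = r := by
  rcases lt_trichotomy r 0 with h | rfl | h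
  · exact ⟨point ⟨-r, by linarith, by linarith [hr.1]⟩ 0, by simp [toReal]⟩
  · exact ⟨zero, rfl⟩
  · exact ⟨point ⟨r, h, hr.2⟩ 1, by simp [toReal]⟩

/-- A continuous retraction of `ℝ` onto the hedgehog with two spines, inverse to `toReal`. -/
noncomputable def ofReal (r : ℝ) : Hedgehog (Fin 2) :=
  (exists_toReal_eq (projIcc (-1 : ℝ) 1 (by norm_num) r).2).choose

theorem toReal_ofReal (r : ℝ) : toReal (ofReal r) = projIcc (-1 : ℝ) 1 (by norm_num) r :=
  (exists_toReal_eq (projIcc (-1 : ℝ) 1 (by norm_num) r).2).choose_spec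

theorem toReal_ofReal_of_mem {r : ℝ} (hr : r ∈ Icc (-1 : ℝ) 1) : toReal (ofReal r) = r := by
  rw [toReal_ofReal, projIcc_of_mem _ hr]

theorem ofReal_toReal (y : Hedgehog (Fin 2)) : ofReal (toReal y) = y :=
  isometry_toReal.injective (toReal_ofReal_of_mem (toReal_mem_Icc y))

theorem continuous_ofReal : Continuous ofReal := by
  rw [isometry_toReal.isEmbedding.continuous_iff]
  exact (continuous_subtype_val.comp continuous_projIcc).congr fun r => (toReal_ofReal r).symm

theorem toReal_image_ofReal_image {S : Set ℝ} (hS : S ⊆ Icc (-1 : ℝ) 1) :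
    toReal '' (ofReal '' S) = S := by
  rw [image_image, image_congr fun r hr => toReal_ofReal_of_mem (hS hr), image_id']

theorem image_toReal_mono_iff {S T : Set (Hedgehog (Fin 2))} :
    toReal '' S ⊆ toReal '' T ↔ S ⊆ T :=
  image_subset_image_iff isometry_toReal.injective

theorem isCompact_of_isClosed {S : Set (Hedgehog (Fin 2))} (hS : IsClosed S) : IsCompact S := by
  have huniv : IsCompact (univ : Set (Hedgehog (Fin 2))) := by
    have : ofReal '' Icc (-1 : ℝ) 1 = univ :=
      eq_univ_of_forall fun y => ⟨_, toReal_mem_Icc y, ofReal_toReal y⟩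
    exact this ▸ isCompact_Icc.image continuous_ofReal
  exact huniv.of_isClosed_subset hS (subset_univ S)

end Hedgehog

open Hedgehog

/-! ### Transfer between the hedgehog and real functions. -/

section Equivalence

variable {X : Type*} [TopologicalSpace X]

/-- Set-valued insertion of continuous compact connected mappings in the hedgehog with two
spines. -/
def HedgehogInsertion (X : Type*) [TopologicalSpace X] : Prop :=
  ∀ Φ θ : X → Set (Hedgehog (Fin 2)),
    (∀ x, Φ x ∈ closedConnectedSubsets (Hedgehog (Fin 2))) → LowerHemicontinuous Φ →
    (∀ x, θ x ∈ compactSubsets (Hedgehog (Fin 2))) → UpperHemicontinuous θ →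
    IsStrictSelection θ Φ →
    ∃ φ : X → Set (Hedgehog (Fin 2)),
      (∀ x, φ x ∈ compactConnectedSubsets (Hedgehog (Fin 2))) ∧ ContinuousSetValued φ ∧
      IsStrictSelection θ φ ∧ IsSelection φ Φ

theorem isStrictSelection_toReal_image {X : Type*} {θ Φ : X → Set (Hedgehog (Fin 2))} :
    IsStrictSelection (fun x => toReal '' θ x) (fun x => toReal '' Φ x) ↔
      IsStrictSelection θ Φ := by
  simp only [IsStrictSelection, IsSelection, image_toReal_mono_iff,
    ← image_sdiff isometry_toReal.injective, image_nonempty]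

theorem CountablyParacompact.hedgehogInsertion [NormalSpace X] (h : CountablyParacompact X) :
    HedgehogInsertion X := by
  intro Φ θ hΦ hΦl hθ hθu hlt
  have hcont := isometry_toReal.continuous
  obtain ⟨a, b, ha, hb, hab, hstrict, hsel⟩ := h.exists_continuous_Icc_between
    (lowerHemicontinuous_image hΦl hcont)
    (fun x => (isCompact_of_isClosed (hΦ x).1).image hcont)
    (fun x => (hΦ x).2.image _ hcont.continuousOn) (upperHemicontinuous_image hθu hcont)
    (fun x => (hθ x).2.2.image hcont) (fun x => (hθ x).1.image _)
    (isStrictSelection_toReal_image.2 hlt)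
  have himg : ∀ x, toReal '' (ofReal '' Icc (a x) (b x)) = Icc (a x) (b x) := fun x =>
    toReal_image_ofReal_image <| (hsel x).trans <| by
      rintro _ ⟨y, -, rfl⟩; exact toReal_mem_Icc y
  have hcpt : ∀ x, IsCompact (ofReal '' Icc (a x) (b x)) := fun x =>
    isCompact_Icc.image continuous_ofReal
  refine ⟨fun x => ofReal '' Icc (a x) (b x), fun x => ⟨(hcpt x).isClosed, hcpt x,
    (isConnected_Icc (hab x)).image _ continuous_ofReal.continuousOn⟩, ⟨?_, ?_⟩, ?_, fun x => ?_⟩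
  · exact lowerHemicontinuous_image
      (lowerHemicontinuous_Icc ha.upperSemicontinuous hb.lowerSemicontinuous hab) continuous_ofReal
  · exact upperHemicontinuous_image
      (upperHemicontinuous_Icc ha.lowerSemicontinuous hb.upperSemicontinuous hab) continuous_ofReal
  · rw [← isStrictSelection_toReal_image]
    simpa only [himg] using hstrict
  · rw [← image_toReal_mono_iff, himg]
    exact hsel x

/-- Take `b` to be the supremum of a map inserted between `[-1, ξ]` and `[-1, η]`: a point of its
value outside `[-1, ξ]` must exceed `ξ`. -/
theorem HedgehogInsertion.exists_lt_le (h : HedgehogInsertion X) {ξ η : X → ℝ}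
    (hξ : UpperSemicontinuous ξ) (hη : LowerSemicontinuous η) (hξ1 : ∀ x, -1 ≤ ξ x)
    (hη1 : ∀ x, η x ≤ 1) (hlt : ∀ x, ξ x < η x) :
    ∃ b : X → ℝ, Continuous b ∧ (∀ x, ξ x < b x) ∧ ∀ x, b x ≤ η x := by
  have hη0 : ∀ x, -1 ≤ η x := fun x => (hξ1 x).trans (hlt x).le
  have hΦimg : ∀ x, toReal '' (ofReal '' Icc (-1) (η x)) = Icc (-1) (η x) := fun x =>
    toReal_image_ofReal_image (Icc_subset_Icc_right (hη1 x))
  have hθimg : ∀ x, toReal '' (ofReal '' Icc (-1) (ξ x)) = Icc (-1) (ξ x) := fun x =>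
    toReal_image_ofReal_image (Icc_subset_Icc_right ((hlt x).le.trans (hη1 x)))
  have hcpt : ∀ r, IsCompact (ofReal '' Icc (-1) r) := fun r => isCompact_Icc.image continuous_ofReal
  obtain ⟨φ, hφ, ⟨hφl, hφu⟩, hθφ, hφΦ⟩ := h (fun x => ofReal '' Icc (-1) (η x))
    (fun x => ofReal '' Icc (-1) (ξ x))
    (fun x => ⟨(hcpt _).isClosed,
      (isConnected_Icc (hη0 x)).image _ continuous_ofReal.continuousOn⟩)
    (lowerHemicontinuous_image (lowerHemicontinuous_Icc upperSemicontinuous_const hη hη0)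
      continuous_ofReal)
    (fun x => ⟨(nonempty_Icc.2 (hξ1 x)).image _, (hcpt _).isClosed, hcpt _⟩)
    (upperHemicontinuous_image (upperHemicontinuous_Icc lowerSemicontinuous_const hξ hξ1)
      continuous_ofReal)
    (by
      rw [← isStrictSelection_toReal_image]
      simp only [hΦimg, hθimg]
      exact ⟨fun x => Icc_subset_Icc_right (hlt x).le,
        fun x => ⟨η x, ⟨hη0 x, le_rfl⟩, fun hx => (hlt x).not_ge hx.2⟩⟩)
  have hcont := isometry_toReal.continuous
  have hc : ∀ x, IsCompact (toReal '' φ x) := fun x => (hφ x).2.1.image hcont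
  have hne : ∀ x, (toReal '' φ x).Nonempty := fun x => (hφ x).2.2.nonempty.image _
  rw [← isStrictSelection_toReal_image] at hθφ
  simp only [hθimg] at hθφ
  refine ⟨fun x => sSup (toReal '' φ x), continuous_iff_lower_upperSemicontinuous.2
    ⟨lowerSemicontinuous_sSup (lowerHemicontinuous_image hφl hcont) hc hne,
      upperSemicontinuous_sSup (upperHemicontinuous_image hφu hcont) hc hne⟩,
    fun x => ?_, fun x => ?_⟩
  · obtain ⟨_, ⟨y, hy, rfl⟩, hyξ⟩ := hθφ.2 x
    refine lt_of_lt_of_le ?_ (le_csSup (hc x).bddAbove ⟨y, hy, rfl⟩)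
    exact not_le.1 fun hle => hyξ ⟨(toReal_mem_Icc y).1, hle⟩
  · have := image_mono (f := toReal) (hφΦ x) ((hc x).sSup_mem (hne x))
    rw [hΦimg] at this
    exact this.2

theorem HedgehogInsertion.boundedStrictInsertion (h : HedgehogInsertion X) :
    BoundedStrictInsertion X := by
  intro ξ η hξ hη hξ1 hη1 hlt
  obtain ⟨b, hb, hb1, hb2⟩ := h.exists_lt_le hξ hη hξ1 hη1 hlt
  obtain ⟨c, hc, hc1, hc2⟩ := h.exists_lt_le (ξ := fun x => -η x) (η := fun x => -ξ x)
    (continuous_neg.comp_lowerSemicontinuous_antitone hη fun _ _ => neg_le_neg)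
    (continuous_neg.comp_upperSemicontinuous_antitone hξ fun _ _ => neg_le_neg)
    (fun x => neg_le_neg (hη1 x)) (fun x => by linarith [hξ1 x]) (fun x => neg_lt_neg (hlt x))
  -- `b` is strict only below and `-c` only above, so their mean is strict on both sides.
  refine ⟨fun x => (b x - c x) / 2, (hb.sub hc).div_const 2, fun x => ?_, fun x => ?_⟩ <;>
    linarith [hb1 x, hb2 x, hc1 x, hc2 x]

end Equivalence

end SetInsertion

theorem lemma3p4 {X : Type*} [TopologicalSpace X] [T2Space X] :
    List.TFAE [
      SetInsertion.CountablyParacompact X ∧ NormalSpace X,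
      ∀ Φ θ : X → Set (SetInsertion.Hedgehog (Fin 2)),
        (∀ x, Φ x ∈ SetInsertion.closedConnectedSubsets (SetInsertion.Hedgehog (Fin 2))) →
        LowerHemicontinuous Φ →
        (∀ x, θ x ∈ SetInsertion.compactSubsets (SetInsertion.Hedgehog (Fin 2))) →
        UpperHemicontinuous θ →
        SetInsertion.IsStrictSelection θ Φ →
        ∃ φ : X → Set (SetInsertion.Hedgehog (Fin 2)),
          (∀ x, φ x ∈ SetInsertion.compactConnectedSubsets (SetInsertion.Hedgehog (Fin 2))) ∧
          SetInsertion.ContinuousSetValued φ ∧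
          SetInsertion.IsStrictSelection θ φ ∧ SetInsertion.IsSelection φ Φ,
      ∀ ξ η : X → ℝ, UpperSemicontinuous ξ → LowerSemicontinuous η → (∀ x, ξ x < η x) →
        ∃ f : X → ℝ, Continuous f ∧ (∀ x, ξ x < f x) ∧ ∀ x, f x < η x] := by
  have key : SetInsertion.BoundedStrictInsertion X →
      SetInsertion.CountablyParacompact X ∧ NormalSpace X :=
    fun h => ⟨h.countablyParacompact, h.normalSpace⟩
  tfae_have 1 → 2 := fun ⟨h, _⟩ => h.hedgehogInsertion
  tfae_have 2 → 1 := fun h => key (SetInsertion.HedgehogInsertion.boundedStrictInsertion h)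
  tfae_have 1 → 3 := fun ⟨h, _⟩ => h.strictInsertion
  tfae_have 3 → 1 := fun h => key fun ξ η hξ hη _ _ hlt => h ξ η hξ hη hlt
  tfae_finish
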